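/- Let $k$ be a field, $k_s$ a separable closure of $k$ and $\Gamma=\mathrm{Gal}(k_s/k)$. Let $F$ and $G$ be smooth algebraic $k$-groups (smooth $k$-group schemes of finite type) with $F$ finite, let $G_{k_s}=G\times_k k_s$, and let $F_\Gamma=F(k_s)\rtimes\Gamma$, with natural splitting $\gamma_F:\Gamma\to F_\Gamma$. An action of $F$ on $G$ by group automorphisms is a $k$-morphism $a:F\times_k G\to G$ that satisfies the axioms of an action of the $k$-group $F$ on the $k$-scheme $G$ and is such that $a(f,xy)=a(f,x)\,a(f,y)$ on points with values in any $k$-scheme. Write $\mathrm{Aut}(G_{k_s})$ for the group of automorphisms of the $k_s$-group scheme $G_{k_s}$, and $\mathrm{SAut}(G_{k_s}/k)$ for the group of $k$-semialgebraic automorphisms of $G_{k_s}$, that is, pairs $(\sigma,s)$ with $\sigma\in\Gamma$ and $s$ an automorphism of the scheme $G_{k_s}$ that covers $\mathrm{Spec}(\sigma^{-1})$ on $\mathrm{Spec}\,k_s$ and is compatible with the multiplication; it contains $\mathrm{Aut}(G_{k_s})$ as the kernel of the projection to $\Gamma$. Let $\mathfrak f_G:\Gamma\to\mathrm{SAut}(G_{k_s}/k)$,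 $\sigma\mapsto(\sigma,\mathrm{id}_G\times\mathrm{Spec}(\sigma^{-1}))$, be the natural splitting. Then the following are equivalent: 1. there is an action $a$ of $F$ on $G$ by group automorphisms; 2. there is a $\Gamma$-equivariant group homomorphism $\rho:F(k_s)\to\mathrm{Aut}(G_{k_s})$, where $\Gamma$ acts on $\mathrm{Aut}(G_{k_s})$ by conjugation via $\mathfrak f_G$; 3. there is a group homomorphism $\Phi:F_\Gamma\to\mathrm{SAut}(G_{k_s}/k)$ with $\Phi\circ\gamma_F=\mathfrak f_G$. More precisely, the three kinds of data correspond to each other. For $f\in F(k_s)$ let $a_f:G_{k_s}\to G_{k_s}$, $x\mapsto a(f,x)$, be the pullback of $a$ along $f$. Then $a\mapsto(f\mapsto a_f)$ is a well-defined bijection from the set of actions $a$ as in 1 to the set of homomorphisms $\rho$ as in 2, and $\Phi\mapsto\Phi|_{F(k_s)}$ is a well-defined bijection from the set of those homomorphisms $\Phi$ as in 3 that commute with the projections of $F_\Gamma$ and $\mathrm{SAut}(G_{k_s}/k)$ to $\Gamma$, to the set of homomorphisms $\rho$ as in 2. -/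

import Mathlib

open CategoryTheory MonoidalCategory CartesianMonoidalCategory Limits AlgebraicGeometry
open scoped MonObj

universe u

noncomputable section

namespace FiniteGroupAction

/-! ## Group schemes and actions over a base -/

/-- A group scheme over `S`. -/
abbrev GroupScheme (S : Scheme.{u}) := Grp (Over S)

/-- For a field `k`: `G` is a smooth algebraic `k`-group, i.e. a smooth group scheme of finite type
over `k` (smooth morphisms are locally of finite presentation). -/
structure IsSmoothAlgebraic {S : Scheme.{u}} (G : GroupScheme S) : Prop where
  smooth : Smooth G.X.hom
  quasiCompact : QuasiCompact G.X.hom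

/-- The diagonal action `a₂ : F × (G × G) ⟶ G × G`, `(f, x, y) ↦ (a (f, x), a (f, y))`. -/
def diagAction {S : Scheme.{u}} {F G : GroupScheme S} (a : F.X ⊗ G.X ⟶ G.X) :
    F.X ⊗ (G.X ⊗ G.X) ⟶ G.X ⊗ G.X :=
  lift ((F.X ◁ fst G.X G.X) ≫ a) ((F.X ◁ snd G.X G.X) ≫ a)

/-- The morphism `a : F × G ⟶ G` is an action of `F` on `G` by group automorphisms. -/
structure IsGroupAction {S : Scheme.{u}} {F G : GroupScheme S} (a : F.X ⊗ G.X ⟶ G.X) : Prop where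
  mul_act : (μ[F.X] ▷ G.X) ≫ a = (α_ F.X F.X G.X).hom ≫ (F.X ◁ a) ≫ a
  one_act : (η[F.X] ▷ G.X) ≫ a = (λ_ G.X).hom
  act_mul : (F.X ◁ μ[G.X]) ≫ a = diagAction a ≫ μ[G.X]

/-! ## The Galois action on points -/

variable (k K : Type u) [Field k] [Field K] [Algebra k K]

/-- The structure morphism `Spec K ⟶ Spec k`. -/
abbrev specMap : Spec (.of K) ⟶ Spec (.of k) := Spec.map (CommRingCat.ofHom (algebraMap k K))

variable {k K}

/-- The `k`-automorphism `Spec σ` of the scheme `Spec K`. -/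
def specGal (σ : K ≃ₐ[k] K) : Spec (.of K) ⟶ Spec (.of K) :=
  Spec.map (CommRingCat.ofHom (σ : K →+* K))

lemma specGal_one : specGal (1 : K ≃ₐ[k] K) = 𝟙 _ := Spec.map_id _

lemma specGal_mul (σ τ : K ≃ₐ[k] K) : specGal (σ * τ) = specGal σ ≫ specGal τ :=
  Spec.map_comp (CommRingCat.ofHom (τ : K →+* K)) (CommRingCat.ofHom (σ : K →+* K))

lemma specGal_specMap (σ : K ≃ₐ[k] K) : specGal σ ≫ specMap k K = specMap k K := by
  rw [specGal, specMap, ← Spec.map_comp, ← CommRingCat.ofHom_comp]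
  congr 2
  ext x
  exact σ.commutes x

variable (K) in
/-- The group `F(K)` of `K`-points of a `k`-group `F`. -/
abbrev Points (F : GroupScheme (Spec (.of k))) : Type u := Over.mk (specMap k K) ⟶ F.X

instance (F : GroupScheme (Spec (.of k))) : Group (Points K F) := Hom.group

/-- `Spec σ`, as a morphism over `Spec k`. -/
def specGalOver (σ : K ≃ₐ[k] K) : Over.mk (specMap k K) ⟶ Over.mk (specMap k K) :=
  Over.homMk (specGal σ) (specGal_specMap σ)

lemma specGalOver_one : specGalOver (1 : K ≃ₐ[k] K) = 𝟙 _ :=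
  Over.OverMorphism.ext specGal_one

lemma specGalOver_mul (σ τ : K ≃ₐ[k] K) :
    specGalOver (σ * τ) = specGalOver σ ≫ specGalOver τ :=
  Over.OverMorphism.ext (specGal_mul σ τ)

variable (K) in
/-- The action of `Γ = Gal(K/k)` on `F(K)` by group automorphisms: `σ` sends
`x : Spec K ⟶ F` to `x ∘ Spec σ`. -/
def galPoints (F : GroupScheme (Spec (.of k))) : (K ≃ₐ[k] K) →* MulAut (Points K F) where
  toFun σ :=
    { toFun := fun x => specGalOver σ ≫ x
      invFun := fun x => specGalOver σ⁻¹ ≫ x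
      left_inv := fun x => by
        dsimp only
        rw [← Category.assoc, ← specGalOver_mul, inv_mul_cancel, specGalOver_one, Category.id_comp]
      right_inv := fun x => by
        dsimp only
        rw [← Category.assoc, ← specGalOver_mul, mul_inv_cancel, specGalOver_one, Category.id_comp]
      map_mul' := fun x y => MonObj.comp_mul _ x y }
  map_one' := by
    ext x : 1
    change specGalOver 1 ≫ x = x
    rw [specGalOver_one, Category.id_comp]
  map_mul' σ τ := by
    ext x : 1
    change specGalOver (σ * τ) ≫ x = specGalOver σ ≫ specGalOver τ ≫ x
    rw [specGalOver_mul, Category.assoc]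

variable (K) in
/-- `F_Γ = F(K) ⋊ Γ`. Its element `SemidirectProduct.inl f * SemidirectProduct.inr σ` is the pair
`(f, σ)`, and `SemidirectProduct.inr` is the natural splitting `γ_F : Γ → F_Γ`. -/
abbrev PointsGal (F : GroupScheme (Spec (.of k))) : Type u :=
  Points K F ⋊[galPoints K F] (K ≃ₐ[k] K)

/-! ## Semialgebraic automorphisms -/

lemma map_fst {W X Y Z S T : Scheme.{u}} (f₁ : W ⟶ S) (f₂ : X ⟶ S) (g₁ : Y ⟶ T) (g₂ : Z ⟶ T)
    (i₁ : W ⟶ Y) (i₂ : X ⟶ Z) (i₃ : S ⟶ T) (e₁ : f₁ ≫ i₃ = i₁ ≫ g₁) (e₂ : f₂ ≫ i₃ = i₂ ≫ g₂) :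
    pullback.map f₁ f₂ g₁ g₂ i₁ i₂ i₃ e₁ e₂ ≫ pullback.fst g₁ g₂ = pullback.fst f₁ f₂ ≫ i₁ :=
  pullback.lift_fst _ _ _

lemma map_snd {W X Y Z S T : Scheme.{u}} (f₁ : W ⟶ S) (f₂ : X ⟶ S) (g₁ : Y ⟶ T) (g₂ : Z ⟶ T)
    (i₁ : W ⟶ Y) (i₂ : X ⟶ Z) (i₃ : S ⟶ T) (e₁ : f₁ ≫ i₃ = i₁ ≫ g₁) (e₂ : f₂ ≫ i₃ = i₂ ≫ g₂) :
    pullback.map f₁ f₂ g₁ g₂ i₁ i₂ i₃ e₁ e₂ ≫ pullback.snd g₁ g₂ = pullback.snd f₁ f₂ ≫ i₂ :=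
  pullback.lift_snd _ _ _

/-- An endomorphism `s` of the scheme `H` is semilinear over `σ ∈ Γ`: it covers the automorphism
`Spec σ⁻¹` of `Spec K` and it is compatible with the multiplication of the `K`-group `H`. -/
structure IsSemialgebraic (H : GroupScheme (Spec (.of K))) (σ : K ≃ₐ[k] K)
    (s : H.X.left ⟶ H.X.left) : Prop where
  comm : H.X.hom ≫ specGal σ⁻¹ = s ≫ H.X.hom
  mul : pullback.map H.X.hom H.X.hom H.X.hom H.X.hom s s (specGal σ⁻¹) comm comm ≫ μ[H.X].left =
    μ[H.X].left ≫ s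

lemma IsSemialgebraic.id (H : GroupScheme (Spec (.of K))) :
    IsSemialgebraic H (1 : K ≃ₐ[k] K) (𝟙 _) := by
  have h : H.X.hom ≫ specGal (1 : K ≃ₐ[k] K)⁻¹ = 𝟙 _ ≫ H.X.hom := by
    rw [inv_one, specGal_one, Category.comp_id, Category.id_comp]
  refine ⟨h, ?_⟩
  have : pullback.map H.X.hom H.X.hom H.X.hom H.X.hom (𝟙 _) (𝟙 _)
      (specGal (1 : K ≃ₐ[k] K)⁻¹) h h = 𝟙 _ := by
    apply pullback.hom_ext <;> simp
  rw [this, Category.comp_id]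
  exact Category.id_comp _

lemma IsSemialgebraic.comp {H : GroupScheme (Spec (.of K))} {σ τ : K ≃ₐ[k] K}
    {s t : H.X.left ⟶ H.X.left} (hs : IsSemialgebraic H σ s) (ht : IsSemialgebraic H τ t) :
    IsSemialgebraic H (σ * τ) (t ≫ s) := by
  have h : H.X.hom ≫ specGal (σ * τ)⁻¹ = (t ≫ s) ≫ H.X.hom := by
    rw [mul_inv_rev, specGal_mul, reassoc_of% ht.comm, hs.comm, Category.assoc]
  refine ⟨h, ?_⟩
  have : pullback.map H.X.hom H.X.hom H.X.hom H.X.hom (t ≫ s) (t ≫ s) (specGal (σ * τ)⁻¹) h h =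
      pullback.map H.X.hom H.X.hom H.X.hom H.X.hom t t (specGal τ⁻¹) ht.comm ht.comm ≫
      pullback.map H.X.hom H.X.hom H.X.hom H.X.hom s s (specGal σ⁻¹) hs.comm hs.comm := by
    apply pullback.hom_ext
    · rw [map_fst, Category.assoc, map_fst, ← Category.assoc, ← Category.assoc, map_fst]
    · rw [map_snd, Category.assoc, map_snd, ← Category.assoc, ← Category.assoc, map_snd]
  rw [this, Category.assoc, hs.mul, reassoc_of% ht.mul]

lemma IsSemialgebraic.inv {H : GroupScheme (Spec (.of K))} {σ : K ≃ₐ[k] K}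
    {s : H.X.left ≅ H.X.left} (hs : IsSemialgebraic H σ s.hom) :
    IsSemialgebraic H σ⁻¹ s.inv := by
  have h : H.X.hom ≫ specGal σ⁻¹⁻¹ = s.inv ≫ H.X.hom := by
    rw [Iso.eq_inv_comp, ← reassoc_of% hs.comm, ← specGal_mul, mul_inv_cancel, specGal_one,
      Category.comp_id]
  refine ⟨h, ?_⟩
  have : pullback.map H.X.hom H.X.hom H.X.hom H.X.hom s.inv s.inv (specGal σ⁻¹⁻¹) h h ≫
      pullback.map H.X.hom H.X.hom H.X.hom H.X.hom s.hom s.hom (specGal σ⁻¹) hs.comm hs.comm =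
      𝟙 _ := by
    apply pullback.hom_ext
    · rw [Category.assoc, map_fst, ← Category.assoc, map_fst, Category.assoc, Iso.inv_hom_id,
        Category.comp_id, Category.id_comp]
    · rw [Category.assoc, map_snd, ← Category.assoc, map_snd, Category.assoc, Iso.inv_hom_id,
        Category.comp_id, Category.id_comp]
  rw [← cancel_mono s.hom, Category.assoc, Category.assoc, ← hs.mul, reassoc_of% this,
    Iso.inv_hom_id, Category.comp_id]

variable (k) in
/-- The group `SAut(H/k)` of `k`-semialgebraic automorphisms of a `K`-group `H`: the pairs `(σ, s)`
with `σ ∈ Γ` and `s` an automorphism of the scheme `H`, semilinear over `σ`. -/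
def SAut (H : GroupScheme (Spec (.of K))) : Subgroup ((K ≃ₐ[k] K) × Aut H.X.left) where
  carrier := {p | IsSemialgebraic H p.1 p.2.hom}
  one_mem' := IsSemialgebraic.id H
  mul_mem' hp hq := hp.comp hq
  inv_mem' hp := IsSemialgebraic.inv hp

variable (k) in
/-- The map `SAut(H/k) → Γ`. -/
def SAut.toGal (H : GroupScheme (Spec (.of K))) : SAut k H →* (K ≃ₐ[k] K) :=
  (MonoidHom.fst _ _).comp (SAut k H).subtype

lemma isSemialgebraic_of_aut (H : GroupScheme (Spec (.of K))) (α : Aut H) :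
    IsSemialgebraic H (1 : K ≃ₐ[k] K) α.hom.hom.hom.left := by
  have h : H.X.hom ≫ specGal (1 : K ≃ₐ[k] K)⁻¹ = α.hom.hom.hom.left ≫ H.X.hom := by
    rw [inv_one, specGal_one, Category.comp_id, Over.w]
  refine ⟨h, ?_⟩
  have e : pullback.map H.X.hom H.X.hom H.X.hom H.X.hom α.hom.hom.hom.left α.hom.hom.hom.left
      (specGal (1 : K ≃ₐ[k] K)⁻¹) h h = (α.hom.hom.hom ⊗ₘ α.hom.hom.hom).left := by
    rw [Over.tensorHom_left]
  rw [e, ← Over.comp_left, ← Over.comp_left, IsMonHom.mul_hom]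

variable (k) in
/-- The inclusion `Aut(H) → SAut(H/k)`, where `Aut(H)` is the group of automorphisms of the
`K`-group scheme `H`. -/
def SAut.ofAut (H : GroupScheme (Spec (.of K))) : Aut H →* SAut k H where
  toFun α := ⟨(1, (Grp.forget _ ⋙ Over.forget _).mapIso α), isSemialgebraic_of_aut H α⟩
  map_one' := by
    apply Subtype.ext
    apply Prod.ext
    · rfl
    · apply Iso.ext
      rfl
  map_mul' α β := by
    apply Subtype.ext
    apply Prod.ext
    · exact (mul_one _).symm
    · apply Iso.ext
      rfl

/-! ## Base change and the natural splitting -/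

variable (K) in
/-- The base change `G_K = G ×_k Spec K` of a `k`-group `G`. -/
def baseChange (G : GroupScheme (Spec (.of k))) : GroupScheme (Spec (.of K)) :=
  (Over.pullback (specMap k K)).mapGrp.obj G

variable (K) in
/-- The projection `G_K ⟶ G`. -/
def proj (G : GroupScheme (Spec (.of k))) : (baseChange K G).X.left ⟶ G.X.left :=
  pullback.fst G.X.hom (specMap k K)

variable (K) in
lemma isPullback_proj (G : GroupScheme (Spec (.of k))) :
    IsPullback (proj K G) (baseChange K G).X.hom G.X.hom (specMap k K) :=
  IsPullback.of_hasPullback _ _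

lemma baseChange_mul_proj (G : GroupScheme (Spec (.of k))) :
    μ[(baseChange K G).X].left ≫ proj K G =
      pullback.map (baseChange K G).X.hom (baseChange K G).X.hom G.X.hom G.X.hom (proj K G)
        (proj K G) (specMap k K) (isPullback_proj K G).w.symm (isPullback_proj K G).w.symm ≫
      μ[G.X].left := by
  have h1 : μ[(baseChange K G).X].left ≫ proj K G =
      (Functor.LaxMonoidal.μ (Over.pullback (specMap k K)) G.X G.X).left ≫
        pullback.fst (G.X ⊗ G.X).hom (specMap k K) ≫ μ[G.X].left := by
    refine (Category.assoc _ _ _).trans ?_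
    congr 1
    exact pullback.lift_fst _ _ _
  rw [h1, ← Category.assoc]
  congr 1
  apply pullback.hom_ext
  · rw [Category.assoc]
    exact (Over.μ_pullback_left_fst_fst G.X G.X).trans (map_fst _ _ _ _ _ _ _ _ _).symm
  · rw [Category.assoc]
    exact (Over.μ_pullback_left_fst_snd G.X G.X).trans (map_snd _ _ _ _ _ _ _ _ _).symm

variable (K) in
/-- The automorphism `id_G × Spec σ⁻¹` of the scheme `G_K = G ×_k Spec K`. -/
def galMor (G : GroupScheme (Spec (.of k))) (σ : K ≃ₐ[k] K) :
    (baseChange K G).X.left ⟶ (baseChange K G).X.left :=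
  (isPullback_proj K G).lift (proj K G) ((baseChange K G).X.hom ≫ specGal σ⁻¹)
    (by rw [Category.assoc, specGal_specMap, (isPullback_proj K G).w])

lemma galMor_proj (G : GroupScheme (Spec (.of k))) (σ : K ≃ₐ[k] K) :
    galMor K G σ ≫ proj K G = proj K G :=
  (isPullback_proj K G).lift_fst _ _ _

lemma galMor_hom (G : GroupScheme (Spec (.of k))) (σ : K ≃ₐ[k] K) :
    galMor K G σ ≫ (baseChange K G).X.hom = (baseChange K G).X.hom ≫ specGal σ⁻¹ :=
  (isPullback_proj K G).lift_snd _ _ _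

lemma galMor_one (G : GroupScheme (Spec (.of k))) : galMor K G 1 = 𝟙 _ := by
  apply (isPullback_proj K G).hom_ext
  · rw [galMor_proj, Category.id_comp]
  · rw [galMor_hom, inv_one, specGal_one, Category.comp_id, Category.id_comp]

lemma galMor_mul (G : GroupScheme (Spec (.of k))) (σ τ : K ≃ₐ[k] K) :
    galMor K G (σ * τ) = galMor K G τ ≫ galMor K G σ := by
  apply (isPullback_proj K G).hom_ext
  · rw [galMor_proj, Category.assoc, galMor_proj, galMor_proj]
  · rw [galMor_hom, Category.assoc, galMor_hom, ← Category.assoc, galMor_hom, mul_inv_rev,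
      specGal_mul, Category.assoc]

variable (K) in
/-- `galMor` as a homomorphism from `Γ` to the automorphism group of the scheme `G_K`. -/
def galAut (G : GroupScheme (Spec (.of k))) : (K ≃ₐ[k] K) →* Aut (baseChange K G).X.left where
  toFun σ :=
    { hom := galMor K G σ
      inv := galMor K G σ⁻¹
      hom_inv_id := by rw [← galMor_mul, inv_mul_cancel, galMor_one]
      inv_hom_id := by rw [← galMor_mul, mul_inv_cancel, galMor_one] }
  map_one' := Iso.ext (galMor_one G)
  map_mul' σ τ := Iso.ext (galMor_mul G σ τ)

lemma isSemialgebraic_galMor (G : GroupScheme (Spec (.of k))) (σ : K ≃ₐ[k] K) :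
    IsSemialgebraic (baseChange K G) σ (galMor K G σ) := by
  refine ⟨(galMor_hom G σ).symm, ?_⟩
  apply (isPullback_proj K G).hom_ext
  · rw [Category.assoc, Category.assoc, galMor_proj, baseChange_mul_proj, ← Category.assoc]
    congr 1
    apply pullback.hom_ext
    · rw [Category.assoc, map_fst, ← Category.assoc, map_fst, Category.assoc, galMor_proj]
    · rw [Category.assoc, map_snd, ← Category.assoc, map_snd, Category.assoc, galMor_proj]
  · have h : μ[(baseChange K G).X].left ≫ (baseChange K G).X.hom =
        pullback.fst _ _ ≫ (baseChange K G).X.hom := Over.w μ[(baseChange K G).X]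
    have h' : (μ[(baseChange K G).X].left ≫ galMor K G σ) ≫ (baseChange K G).X.hom =
        (μ[(baseChange K G).X].left ≫ (baseChange K G).X.hom) ≫ specGal σ⁻¹ := by
      rw [Category.assoc, Category.assoc]
      exact congrArg _ (galMor_hom G σ)
    rw [h', h, Category.assoc, h, ← Category.assoc, map_fst, Category.assoc, Category.assoc]
    exact congrArg _ (galMor_hom G σ)

variable (K) in
/-- The natural splitting `𝔣_G : Γ → SAut(G_K/k)`, `σ ↦ (σ, id_G × Spec σ⁻¹)`. -/
def galSplitting (G : GroupScheme (Spec (.of k))) : (K ≃ₐ[k] K) →* SAut k (baseChange K G) :=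
  ((MonoidHom.id _).prod (galAut K G)).codRestrict (SAut k (baseChange K G))
    (isSemialgebraic_galMor G)

/-! ## The three kinds of data, and the maps between them -/

section Data

variable {F G : GroupScheme (Spec (.of k))}

/-- For a morphism `a : F × G ⟶ G` and a point `f ∈ F(K)`, the pullback `a_f : G_K ⟶ G_K` of `a`
along `f`. It is the `K`-morphism that on points is `x ↦ a (f, x)`. -/
def actAt (a : F.X ⊗ G.X ⟶ G.X) (f : Points K F) : (baseChange K G).X ⟶ (baseChange K G).X :=
  let T : Over (Spec (.of k)) := Over.mk (proj K G ≫ G.X.hom)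
  let p : T ⟶ G.X := Over.homMk (proj K G)
  let q : T ⟶ Over.mk (specMap k K) :=
    Over.homMk (baseChange K G).X.hom (isPullback_proj K G).w.symm
  Over.homMk
    ((isPullback_proj K G).lift (lift (q ≫ f) p ≫ a).left (baseChange K G).X.hom
      ((Over.w (lift (q ≫ f) p ≫ a)).trans (isPullback_proj K G).w))
    ((isPullback_proj K G).lift_snd _ _ _)

/-- The homomorphism `ρ : F(K) → Aut(G_K)` is a morphism of `Γ`-groups, where `Γ` acts on
`Aut(G_K)` by conjugation via `𝔣_G` inside `SAut(G_K/k)`. -/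
def IsGalEquivariant (ρ : Points K F →* Aut (baseChange K G)) : Prop :=
  ∀ (σ : K ≃ₐ[k] K) (f : Points K F),
    SAut.ofAut k _ (ρ (galPoints K F σ f)) =
      galSplitting K G σ * SAut.ofAut k _ (ρ f) * (galSplitting K G σ)⁻¹

/-- The homomorphism `Φ : F_Γ → SAut(G_K/k)` restricts to the splitting `𝔣_G` on `γ_F(Γ)`. -/
def ExtendsSplitting (Φ : PointsGal K F →* SAut k (baseChange K G)) : Prop :=
  ∀ σ : K ≃ₐ[k] K, Φ (SemidirectProduct.inr σ) = galSplitting K G σ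

/-- The homomorphism `Φ : F_Γ → SAut(G_K/k)` commutes with the projections to `Γ`. -/
def IsOverGal (Φ : PointsGal K F →* SAut k (baseChange K G)) : Prop :=
  ∀ x : PointsGal K F, SAut.toGal k _ (Φ x) = SemidirectProduct.rightHom x

/-- The morphism `a` induces `ρ`, i.e. `ρ(f) = a_f` for all `f ∈ F(K)`. -/
def Induces (a : F.X ⊗ G.X ⟶ G.X) (ρ : Points K F →* Aut (baseChange K G)) : Prop :=
  ∀ f : Points K F, (ρ f).hom.hom.hom = actAt a f

/-- The homomorphism `Φ` restricts to `ρ` on `F(K)`. -/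
def RestrictsTo (Φ : PointsGal K F →* SAut k (baseChange K G))
    (ρ : Points K F →* Aut (baseChange K G)) : Prop :=
  ∀ f : Points K F, Φ (SemidirectProduct.inl f) = SAut.ofAut k _ (ρ f)

end Data

end FiniteGroupAction

end

open FiniteGroupAction

noncomputable section

namespace FiniteGroupAction

/-! Write `K` for `k_s`. A finite smooth `F` is étale, so over the separably closed field `K` it is
a disjoint union of copies of Spec K, one for each point of `F(K)`. A morphism F × G × Spec K ⟶ G is
therefore a family, indexed by `F(K)`, of morphisms G × Spec K ⟶ G, that is, of K-endomorphisms of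
the scheme `G_K` (`existsUnique_graphAt_comp`). By Galois descent (`existsUnique_fst_comp_eq`) it
comes from a morphism F × G ⟶ G exactly when it is Γ-invariant, and for the family given by `ρ` this
is the equivariance of `ρ` (`isGalEquivariant_iff_flat`). The axioms of an action can be tested on
`K`-points (`hom_ext_of_points`), where they say that `ρ` is a homomorphism with values in group
automorphisms.

Since `K / k` may be infinite, K ⊗ K need not be a product of copies of `K` indexed by Γ. The
descent uses instead that the maps x ⊗ y ↦ x σ(y) are jointly injective, together with the
separatedness of `G`, which holds for every group scheme over a field.

The passage between `ρ` and `Φ` is group theory: `Aut(G_K)` is the kernel of SAut ⟶ Γ, and the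
compatibility needed to glue `ρ` and the splitting into a homomorphism on F(K) ⋊ Γ is equivariance.
For bare existence, the trivial `ρ` already gives 3 ⇒ 2. -/

/-! ### Finite smooth schemes over a separably closed field -/

lemma etale_of_subsingleton {R S : Type u} [CommRing R] [CommRing S] [Subsingleton S]
    (f : R →+* S) : f.Etale := by
  algebraize [f]
  have : IsLocalization.Away (0 : R) S :=
    { map_units := fun _ => isUnit_of_subsingleton _
      surj := fun _ => ⟨(0, 1), Subsingleton.elim _ _⟩
      exists_of_eq := fun _ => ⟨⟨0, Submonoid.mem_powers _⟩, by simp⟩ }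
  exact Algebra.Etale.of_isLocalizationAway (0 : R)

/-- A standard smooth algebra is étale over a polynomial ring. Finiteness leaves no room for
variables: for nonzero `B`, flatness embeds the polynomial ring into `B`, which is integral over
`K`. -/
lemma etale_of_isStandardSmooth_of_finite {K B : Type u} [Field K] [CommRing B]
    (f : K →+* B) (hf : f.IsStandardSmooth) (hfin : f.Finite) : f.Etale := by
  cases subsingleton_or_nontrivial B
  · exact etale_of_subsingleton f
  obtain ⟨n, g, rfl, hg⟩ := hf.exists_etale_mvPolynomial
  have hinj : Function.Injective g := by
    have hflat : g.Flat := (RingHom.Etale.iff_flat_and_formallyUnramified.mp hg).1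
    algebraize [g]
    have : Module.IsTorsionFree (MvPolynomial (Fin n) K) B := inferInstance
    exact FaithfulSMul.algebraMap_injective (MvPolynomial (Fin n) K) B
  have hint : (MvPolynomial.C : K →+* MvPolynomial (Fin n) K).IsIntegral := fun x =>
    (hfin.to_isIntegral (g x)).elim fun p hp => ⟨p, hp.1, hinj (by
      rw [map_zero, Polynomial.hom_eval₂]; exact hp.2)⟩
  obtain rfl : n = 0 := by
    by_contra hn
    exact MvPolynomial.transcendental_X K (⟨0, by omega⟩ : Fin n)
      (IsIntegral.isAlgebraic (hint _))
  exact RingHom.Etale.stableUnderComposition _ _ (RingHom.Etale.of_bijective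
    (MvPolynomial.isEmptyRingEquiv K (Fin 0)).symm.bijective) hg

/-- Being étale is local on the target. The localizations stay finite because `A` is Artinian, so
each of them is a quotient of `A`. -/
lemma etale_of_smooth_of_finite {K A : Type u} [Field K] [CommRing A]
    (f : K →+* A) (hf : f.Smooth) (hfin : f.Finite) : f.Etale := by
  obtain ⟨s, hs, h⟩ := RingHom.smooth_iff_locally_isStandardSmooth.mp hf
  refine RingHom.Etale.ofLocalizationSpanTarget f s hs fun t => ?_
  refine etale_of_isStandardSmooth_of_finite _ (h t t.2) (RingHom.Finite.comp ?_ hfin)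
  algebraize [f]
  have : IsArtinianRing A := isArtinian_of_tower K inferInstance
  exact RingHom.Finite.of_surjective _ (IsArtinianRing.localization_surjective
    (Submonoid.powers t.1) (Localization.Away t.1))

/-- The residue fields of an étale `K`-algebra are finite separable over `K`, hence equal to `K`. -/
lemma exists_ker_eq_of_etale {K A : Type u} [Field K] [IsSepClosed K] [CommRing A] (f : K →+* A)
    (hf : f.Etale) (p : PrimeSpectrum A) :
    ∃ g : A →+* K, g.comp f = RingHom.id K ∧ RingHom.ker g = p.asIdeal := by
  algebraize [f]
  have := Algebra.FormallyUnramified.finite_of_free K A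
  have : IsArtinianRing A := isArtinian_of_tower K inferInstance
  let := Ideal.Quotient.field p.asIdeal
  have : Algebra.IsSeparable K (A ⧸ p.asIdeal) :=
    (Algebra.FormallyUnramified.iff_isSeparable _ _).mp inferInstance
  let e : K ≃ₐ[K] A ⧸ p.asIdeal :=
    AlgEquiv.ofBijective (Algebra.ofId K _) (IsSepClosed.algebraMap_bijective _ _)
  refine ⟨(e.symm : (A ⧸ p.asIdeal) →+* K).comp (Ideal.Quotient.mk p.asIdeal), ?_, ?_⟩
  · ext x
    exact e.symm.commutes x
  · rw [RingHom.ker_comp_of_injective _ e.symm.injective, Ideal.mk_ker]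

lemma exists_iso_spec {R : CommRingCat.{u}} {X : Scheme.{u}} (p : X ⟶ Spec R) [IsAffineHom p] :
    ∃ (A : CommRingCat.{u}) (φ : R ⟶ A) (e : X ≅ Spec A), p = e.hom ≫ Spec.map φ := by
  have : IsAffine X := isAffine_of_isAffineHom p
  exact ⟨_, Spec.preimage (X.isoSpec.inv ≫ p), X.isoSpec, by simp⟩

lemma etale_of_smooth_of_isFinite {K : Type u} [Field K] {X : Scheme.{u}} (p : X ⟶ Spec (.of K))
    [Smooth p] [IsFinite p] : Etale p := by
  obtain ⟨A, φ, e, rfl⟩ := exists_iso_spec p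
  have hs : Smooth (Spec.map φ) := by
    simpa using (inferInstance : Smooth (e.inv ≫ e.hom ≫ Spec.map φ))
  have hf : IsFinite (Spec.map φ) := by
    simpa using (inferInstance : IsFinite (e.inv ≫ e.hom ≫ Spec.map φ))
  have : Etale (Spec.map φ) := (HasRingHomProperty.Spec_iff (P := @Etale)).mpr
    (etale_of_smooth_of_finite φ.hom ((HasRingHomProperty.Spec_iff (P := @Smooth)).mp hs)
      ((IsFinite.SpecMap_iff φ).mp hf))
  infer_instance

lemma exists_section_of_etale {K : Type u} [Field K] [IsSepClosed K] {X : Scheme.{u}}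
    (p : X ⟶ Spec (.of K)) [Etale p] [IsFinite p] (x : X) :
    ∃ s : Spec (.of K) ⟶ X, s ≫ p = 𝟙 _ ∧ x ∈ Set.range s := by
  obtain ⟨A, φ, e, rfl⟩ := exists_iso_spec p
  have he : Etale (Spec.map φ) := by
    simpa using (inferInstance : Etale (e.inv ≫ e.hom ≫ Spec.map φ))
  obtain ⟨g, hg, hker⟩ := exists_ker_eq_of_etale φ.hom
    ((HasRingHomProperty.Spec_iff (P := @Etale)).mp he) (e.hom x)
  let z : Spec (.of K) := IsLocalRing.closedPoint K
  have hz : Spec.map (CommRingCat.ofHom g) z = e.hom x := by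
    refine PrimeSpectrum.ext (Eq.trans ?_ hker)
    change (IsLocalRing.maximalIdeal K).comap g = _
    rw [IsLocalRing.maximalIdeal_eq_bot]
    rfl
  refine ⟨Spec.map (CommRingCat.ofHom g) ≫ e.inv, ?_, z, ?_⟩
  · rw [Category.assoc, Iso.inv_hom_id_assoc, ← Spec.map_comp, ← Spec.map_id]
    congr 1
    ext1
    exact hg
  · rw [Scheme.Hom.comp_apply, hz, ← Scheme.Hom.comp_apply, Iso.hom_inv_id]
    rfl

/-- By cancellation the section is étale; being a split monomorphism as well, it is a flat
monomorphism locally of finite presentation. -/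
lemma isOpenImmersion_of_section {S X : Scheme.{u}} (p : X ⟶ S) [Etale p] (s : S ⟶ X)
    (hs : s ≫ p = 𝟙 S) : IsOpenImmersion s := by
  have : Etale (s ≫ p) := by rw [hs]; infer_instance
  have : Etale s := Etale.of_comp s p
  have : IsSplitMono s := ⟨⟨p, hs⟩⟩
  exact IsOpenImmersion.of_flat_of_mono s

/-- Agreement at the single point makes `s` factor through the open immersion `t`; composing with
`p` shows that the factor is the identity. -/
lemma section_unique {S X : Scheme.{u}} [Subsingleton S] (p : X ⟶ S) [Etale p] (s t : S ⟶ X)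
    (hs : s ≫ p = 𝟙 S) (ht : t ≫ p = 𝟙 S) (z : S) (h : s z = t z) : s = t := by
  have := isOpenImmersion_of_section p t ht
  have hr : Set.range s ⊆ Set.range t := by
    rintro _ ⟨y, rfl⟩
    exact ⟨z, by rw [← h, Subsingleton.elim y z]⟩
  have hl := IsOpenImmersion.lift_fac t s hr
  have hl' := hl =≫ p
  rw [Category.assoc, ht, hs, Category.comp_id] at hl'
  rw [← hl, hl', Category.id_comp]

/-! ### Splitting F × X × Spec K into pieces indexed by F(K) -/

variable {k K : Type u} [Field k] [Field K] [Algebra k K]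

/-- The morphism `X × Spec K ⟶ F × X × Spec K`, `(x, u) ↦ (f (u), x, u)`, for a point
`f : Spec K ⟶ F`. -/
def graphAt {F : Over (Spec (.of k))} (f : Over.mk (specMap k K) ⟶ F)
    (X : Over (Spec (.of k))) :
    X ⊗ Over.mk (specMap k K) ⟶ (F ⊗ X) ⊗ Over.mk (specMap k K) :=
  lift (lift (snd _ _ ≫ f) (fst _ _)) (snd _ _)

/-- This reduces questions about the pieces of F × X × Spec K to the sections (f, id) of F × Spec K
⟶ Spec K. -/
lemma isPullback_graphAt {F : Over (Spec (.of k))} (f : Over.mk (specMap k K) ⟶ F)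
    (X : Over (Spec (.of k))) :
    IsPullback (graphAt f X) (snd _ _) (fst F X ▷ Over.mk (specMap k K)) (lift f (𝟙 _)) := by
  refine ⟨⟨?_⟩, ⟨PullbackCone.IsLimit.mk _
    (fun c => lift (c.fst ≫ fst _ _ ≫ snd _ _) (c.fst ≫ snd _ _)) ?_ ?_ ?_⟩⟩
  · ext1 <;> simp [graphAt]
  · intro c
    have h1 := c.condition =≫ fst _ _
    have h2 := c.condition =≫ snd _ _
    simp at h1 h2
    rw [graphAt, comp_lift, comp_lift]
    ext1
    · ext1 <;> simp [h1, h2]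
    · simp
  · intro c
    have h2 := c.condition =≫ snd _ _
    simp at h2
    simp [h2]
  · intro c m h1 h2
    ext1 <;> simp [← h1, graphAt]

lemma nonempty_isColimit_graphAt [IsSepClosed K] (F : Over (Spec (.of k))) [Smooth F.hom]
    [IsFinite F.hom] (X : Over (Spec (.of k))) :
    Nonempty (IsColimit (Cofan.mk ((F ⊗ X) ⊗ Over.mk (specMap k K)).left
      fun f : Over.mk (specMap k K) ⟶ F => (graphAt f X).left)) := by
  let U := Over.mk (specMap k K)
  let p : (F ⊗ U).left ⟶ Spec (.of K) := (snd F U).left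
  have : Smooth p := inferInstanceAs (Smooth (pullback.snd F.hom (specMap k K)))
  have : IsFinite p := inferInstanceAs (IsFinite (pullback.snd F.hom (specMap k K)))
  have : Etale p := etale_of_smooth_of_isFinite p
  let s (f : U ⟶ F) : Spec (.of K) ⟶ (F ⊗ U).left := (lift f (𝟙 U)).left
  have hs (f : U ⟶ F) : s f ≫ p = 𝟙 _ := by
    simp only [s, p, ← Over.comp_left, lift_snd]
    rfl
  have hs_inj : Function.Injective s := fun f g h =>
    (lift_fst f (𝟙 U)).symm.trans ((congrArg (· ≫ fst F U) (Over.OverMorphism.ext h)).trans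
      (lift_fst g (𝟙 U)))
  have hsub : Subsingleton (Spec (CommRingCat.of K)) :=
    inferInstanceAs (Subsingleton (PrimeSpectrum K))
  have hpb (f : U ⟶ F) : IsPullback (graphAt f X).left (snd X U).left (fst F X ▷ U).left (s f) :=
    (isPullback_graphAt f X).map (Over.forget _)
  have (f : U ⟶ F) : IsOpenImmersion (s f) := isOpenImmersion_of_section p _ (hs f)
  have (f : U ⟶ F) : IsOpenImmersion (graphAt f X).left :=
    MorphismProperty.of_isPullback (P := @IsOpenImmersion) (hpb f).flip inferInstance
  apply nonempty_isColimit_cofanMk_of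
  -- The pieces cover: some section passes through the image of `y` in F × Spec K, and every section
  -- has the form (f, id).
  · refine eq_top_iff.mpr fun y _ => ?_
    obtain ⟨t, ht, z, hz⟩ := exists_section_of_etale p ((fst F X ▷ U).left y)
    let t' : U ⟶ F ⊗ U := Over.homMk t (by
      rw [← Over.w (snd F U), reassoc_of% ht])
    have ht' : lift (t' ≫ fst F U) (𝟙 U) = t' := by
      refine CartesianMonoidalCategory.hom_ext _ _ (by simp) ?_
      rw [lift_snd]
      exact (Over.OverMorphism.ext ht).symm
    obtain ⟨w, hw, -⟩ := Scheme.exists_preimage_of_isPullback (hpb (t' ≫ fst F U)) y z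
      (by rw [← hz]; simp only [s, ht']; rfl)
    exact TopologicalSpace.Opens.mem_iSup.mpr ⟨t' ≫ fst F U, w, hw⟩
  -- The pieces are disjoint: a common point would make two sections over the one-point scheme Spec
  -- K meet, hence coincide.
  · intro f g hfg
    refine TopologicalSpace.Opens.coe_disjoint.mp (Set.disjoint_left.mpr ?_)
    rintro _ ⟨v, rfl⟩ ⟨w, hw⟩
    refine hfg (hs_inj (section_unique p _ _ (hs f) (hs g) ((snd X U).left v) ?_))
    have hv : (fst F X ▷ U).left ((graphAt f X).left v) = s f ((snd X U).left v) := by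
      rw [← Scheme.Hom.comp_apply, (hpb f).w, Scheme.Hom.comp_apply]
    have hw' : (fst F X ▷ U).left ((graphAt g X).left w) = s g ((snd X U).left w) := by
      rw [← Scheme.Hom.comp_apply, (hpb g).w, Scheme.Hom.comp_apply]
    rw [← hv, ← hw, hw']
    exact congrArg (s g) (hsub.elim _ _)

/-- Morphisms out of `F × X × Spec K` are families of morphisms out of `X × Spec K`, indexed by the
`K`-points of the finite smooth scheme `F`. -/
lemma existsUnique_graphAt_comp [IsSepClosed K] (F : Over (Spec (.of k))) [Smooth F.hom]
    [IsFinite F.hom] (X Y : Over (Spec (.of k)))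
    (h : (Over.mk (specMap k K) ⟶ F) → (X ⊗ Over.mk (specMap k K) ⟶ Y)) :
    ∃! g : (F ⊗ X) ⊗ Over.mk (specMap k K) ⟶ Y, ∀ f, graphAt f X ≫ g = h f := by
  obtain ⟨hc⟩ := nonempty_isColimit_graphAt (K := K) F X
  have hfac f : (graphAt f X).left ≫ Cofan.IsColimit.desc hc (fun f => (h f).left) = (h f).left :=
    Cofan.IsColimit.fac hc _ f
  refine ⟨Over.homMk (Cofan.IsColimit.desc hc fun f => (h f).left) ?_, ?_, ?_⟩
  · refine Cofan.IsColimit.hom_ext hc _ _ fun f => ?_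
    change (graphAt f X).left ≫ _ = (graphAt f X).left ≫ _
    rw [reassoc_of% hfac f, Over.w, Over.w]
  · intro f
    exact Over.OverMorphism.ext (hfac f)
  · intro g hg
    refine Over.OverMorphism.ext (Cofan.IsColimit.hom_ext hc _ _ fun f => ?_)
    exact (congrArg CommaMorphism.left (hg f)).trans (hfac f).symm

/-! ### Galois descent of morphisms, for possibly infinite extensions -/

section Ring

open TensorProduct

/-- For a Galois extension `K / k`, elements of `K` that are linearly independent over `k` are
separated by the conjugates: if `∑ cᵢ σ(bᵢ) = 0` for all `σ ∈ Gal(K/k)`, then all `cᵢ` vanish. -/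
lemma eq_zero_of_sum_mul_gal_eq_zero {k K I : Type*} [Field k] [Field K] [Algebra k K]
    [IsGalois k K] {b : I → K} (hb : LinearIndependent k b) (c : I →₀ K)
    (h : ∀ σ : K ≃ₐ[k] K, (c.sum fun i x => x * σ (b i)) = 0) : c = 0 := by
  classical
  have hfix (x : FixedPoints.subfield (K ≃ₐ[k] K) K) : ∃ y : k, algebraMap k K y = x :=
    (InfiniteGalois.mem_range_algebraMap_iff_fixed (x : K)).mpr fun f => x.2 f
  choose r hr using hfix
  have hb' : LinearIndependent (FixedPoints.subfield (K ≃ₐ[k] K) K) b := by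
    rw [linearIndependent_iff'] at hb ⊢
    intro s g hg i hi
    have h0 := hb s (fun i => r (g i)) (by
      rw [← hg]
      exact Finset.sum_congr rfl fun i _ => by rw [Algebra.smul_def, hr]; rfl) i hi
    rw [← Subtype.coe_inj, ← hr, h0, map_zero]
    rfl
  have hs : LinearIndepOn (FixedPoints.subfield (K ≃ₐ[k] K) K) id
      ((c.support.image b : Finset K) : Set K) :=
    hb'.linearIndepOn_id.mono (by simp)
  -- Artin's lemma: elements independent over the fixed field give functions σ ↦ σ(b) on the group
  -- that are independent over `K`. The group may be infinite; only the set of elements is finite,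
  -- whence the restriction to the support of `c`.
  have hs' := FixedPoints.linearIndependent_smul_of_linearIndependent _ _ hs
  have hli := LinearIndependent.comp hs'
    (fun i : c.support => ⟨b i, Finset.mem_coe.mpr (Finset.mem_image_of_mem b i.2)⟩)
    (fun i j hij => Subtype.ext (hb.injective (congrArg Subtype.val hij)))
  rw [linearIndependent_iff'] at hli
  ext i
  by_contra hi
  refine hi (hli Finset.univ (fun i => c i) ?_ ⟨i, Finsupp.mem_support_iff.mpr hi⟩
    (Finset.mem_univ _))
  ext σ
  rw [Finset.sum_apply]
  exact (Finset.sum_coe_sort c.support (fun i => c i * σ (b i))).trans (h σ)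

/-- Expand `z` in a `k`-basis of `K`, with coefficients in `B`. Every `K`-linear functional on `B`
turns the hypothesis into the preceding lemma, and functionals separate the elements of `B`. -/
lemma jointly_injective_lift_gal (k K B : Type*) [Field k] [Field K] [Algebra k K] [IsGalois k K]
    [CommRing B] [Algebra k B] [Algebra K B] [IsScalarTower k K B] (z : B ⊗[k] K)
    (h : ∀ σ : K ≃ₐ[k] K, Algebra.TensorProduct.lift (AlgHom.id k B)
      ((IsScalarTower.toAlgHom k K B).comp (σ : K →ₐ[k] K)) (fun _ _ => .all _ _) z = 0) :
    z = 0 := by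
  classical
  let b := Module.Basis.ofVectorSpace k K
  let e := TensorProduct.equivFinsuppOfBasisRight (M := B) b
  obtain ⟨m, rfl⟩ := e.symm.surjective z
  suffices m = 0 by rw [this, map_zero]
  ext i
  refine (Module.forall_dual_apply_eq_zero_iff K (m i)).mp fun φ => ?_
  have hc : m.mapRange φ (map_zero φ) = 0 := by
    refine eq_zero_of_sum_mul_gal_eq_zero b.linearIndependent _ fun σ => ?_
    have := congrArg φ (h σ)
    rw [TensorProduct.equivFinsuppOfBasisRight_symm_apply, Finsupp.sum, map_sum, map_sum,
      map_zero] at this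
    rw [Finsupp.sum_mapRange_index (by simp), Finsupp.sum, ← this]
    refine Finset.sum_congr rfl fun i _ => ?_
    rw [Algebra.TensorProduct.lift_tmul, mul_comm (AlgHom.id k B _)]
    change _ = φ (algebraMap K B (σ (b i)) * m i)
    rw [← Algebra.smul_def, map_smul, smul_eq_mul, mul_comm]
  simpa using DFunLike.congr_fun hc i

end Ring

/-- Since `Y` is separated, the equalizer of `g` and `h` is a closed subscheme of the affine scheme
`X`. All the test morphisms factor through it, so a function vanishing on it is killed by every `ψ
i` and is zero. -/
lemma hom_ext_of_jointly_injective {S : Scheme.{u}} {X Y : Over S} [IsSeparated Y.hom]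
    {R : CommRingCat.{u}} (e : X.left ≅ Spec R) {I : Type*} {W : I → Over S} (t : ∀ i, W i ⟶ X)
    {B : I → CommRingCat.{u}} (j : ∀ i, Spec (B i) ⟶ (W i).left) (ψ : ∀ i, R ⟶ B i)
    (hψ : ∀ i, j i ≫ (t i).left ≫ e.hom = Spec.map (ψ i))
    (hinj : ∀ r : R, (∀ i, ψ i r = 0) → r = 0) (g h : X ⟶ Y) (hgh : ∀ i, t i ≫ g = t i ≫ h) :
    g = h := by
  let c := (equalizer.ι g h).left ≫ e.hom
  have hl i : (j i ≫ (equalizer.lift (t i) (hgh i)).left) ≫ c = Spec.map (ψ i) := by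
    rw [← hψ, Category.assoc, ← Category.assoc _ _ e.hom, ← Over.comp_left, equalizer.lift_ι]
  have : IsIso c := by
    apply IsClosedImmersion.isIso_of_injective_of_isAffine
    rw [injective_iff_map_eq_zero]
    intro r hr
    obtain ⟨r, rfl⟩ := (Scheme.ΓSpecIso R).commRingCatIsoToRingEquiv.symm.surjective r
    rw [hinj r, map_zero]
    intro i
    have h1 := congrArg (fun m => m.appTop ((Scheme.ΓSpecIso R).inv r)) (hl i)
    rw [Scheme.Hom.comp_appTop, CommRingCat.comp_apply] at h1
    have h2 : c.appTop ((Scheme.ΓSpecIso R).inv r) = 0 := hr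
    rw [h2, map_zero, ← CommRingCat.comp_apply, ← Scheme.ΓSpecIso_inv_naturality,
      CommRingCat.comp_apply] at h1
    exact (Scheme.ΓSpecIso (B i)).symm.commRingCatIsoToRingEquiv.injective
      (h1.symm.trans (map_zero _).symm)
  have : IsIso (equalizer.ι g h).left := IsIso.of_isIso_comp_right _ e.hom
  refine Over.OverMorphism.ext ?_
  rw [← cancel_epi (equalizer.ι g h).left, ← Over.comp_left, equalizer.condition, Over.comp_left]

open TensorProduct in
-- The morphism `v` makes `B` a `K`-algebra, and (id, σ ∘ v) is the spectrum of the map B ⊗ K ⟶ B, b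
-- ⊗ x ↦ b σ(x).
lemma hom_ext_of_gal_of_spec [IsGalois k K] {Y : Over (Spec (.of k))} [IsSeparated Y.hom]
    {B : CommRingCat.{u}} {w : Spec B ⟶ Spec (.of k)} (v : Over.mk w ⟶ Over.mk (specMap k K))
    (g h : Over.mk w ⊗ Over.mk (specMap k K) ⟶ Y)
    (hgh : ∀ σ : K ≃ₐ[k] K, lift (𝟙 _) (v ≫ specGalOver σ) ≫ g =
      lift (𝟙 _) (v ≫ specGalOver σ) ≫ h) :
    g = h := by
  obtain ⟨φ, hφ⟩ : ∃ φ, Spec.map φ = v.left := Spec.map_surjective _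
  let := φ.hom.toAlgebra
  let := (φ.hom.comp (algebraMap k K)).toAlgebra
  have : IsScalarTower k K B := .of_algebraMap_eq' rfl
  obtain rfl : w = Spec.map (CommRingCat.ofHom (algebraMap k B)) := by
    refine (Over.w v).symm.trans ?_
    rw [← hφ]
    exact (Spec.map_comp _ _).symm
  let ψ (σ : K ≃ₐ[k] K) : CommRingCat.of (TensorProduct k B K) ⟶ B :=
    CommRingCat.ofHom (Algebra.TensorProduct.lift (AlgHom.id k B)
      ((IsScalarTower.toAlgHom k K B).comp (σ : K →ₐ[k] K)) (fun _ _ => .all _ _)).toRingHom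
  refine hom_ext_of_jointly_injective (pullbackSpecIso k B K) _ (fun _ => 𝟙 (Spec B)) ψ
    (fun σ => ?_) (jointly_injective_lift_gal k K B) g h hgh
  have h1 : Spec.map (ψ σ) ≫ Spec.map (CommRingCat.ofHom
      (Algebra.TensorProduct.includeLeftRingHom : B →+* TensorProduct k B K)) = 𝟙 _ := by
    rw [← Spec.map_comp, ← Spec.map_id]
    congr 1
    ext x
    refine (Algebra.TensorProduct.lift_tmul (AlgHom.id k B) _ (fun _ _ => .all _ _) x 1).trans ?_
    rw [map_one, mul_one]
    rfl
  have h2 : Spec.map (ψ σ) ≫ Spec.map (CommRingCat.ofHom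
      (Algebra.TensorProduct.includeRight : K →ₐ[k] TensorProduct k B K).toRingHom) =
      v.left ≫ specGal σ := by
    rw [← hφ, specGal, ← Spec.map_comp, ← Spec.map_comp]
    congr 1
    ext x
    refine (Algebra.TensorProduct.lift_tmul (AlgHom.id k B) _ (fun _ _ => .all _ _) 1 x).trans ?_
    rw [map_one, one_mul]
    rfl
  rw [Category.id_comp]
  refine (Iso.eq_comp_inv _).mp (pullback.hom_ext ?_ ?_)
  · exact (congrArg CommaMorphism.left (lift_fst (𝟙 _) (v ≫ specGalOver σ))).trans
      (((Category.assoc _ _ _).trans (congrArg (Spec.map (ψ σ) ≫ ·)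
        (pullbackSpecIso_inv_fst k B K))).trans h1).symm
  · exact (congrArg CommaMorphism.left (lift_snd (𝟙 _) (v ≫ specGalOver σ))).trans
      (((Category.assoc _ _ _).trans (congrArg (Spec.map (ψ σ) ≫ ·)
        (pullbackSpecIso_inv_snd k B K))).trans h2).symm

lemma whiskerRight_comp_eq_of_gal [IsGalois k K] {W Y : Over (Spec (.of k))} [IsSeparated Y.hom]
    (v : W ⟶ Over.mk (specMap k K)) (g h : W ⊗ Over.mk (specMap k K) ⟶ Y)
    (hgh : ∀ σ : K ≃ₐ[k] K, lift (𝟙 _) (v ≫ specGalOver σ) ≫ g =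
      lift (𝟙 _) (v ≫ specGalOver σ) ≫ h)
    {B : CommRingCat.{u}} {w : Spec B ⟶ Spec (.of k)} (j : Over.mk w ⟶ W) :
    j ▷ Over.mk (specMap k K) ≫ g = j ▷ Over.mk (specMap k K) ≫ h := by
  refine hom_ext_of_gal_of_spec (j ≫ v) _ _ fun σ => ?_
  have := j ≫= hgh σ
  rw [comp_lift_assoc, comp_lift_assoc, Category.comp_id] at this
  rwa [lift_whiskerRight_assoc, lift_whiskerRight_assoc, Category.id_comp, Category.assoc]

/-- Let `K / k` be Galois, `W` a `k`-scheme with a `k`-morphism `v : W ⟶ Spec K`. The morphisms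
`W ⟶ W × Spec K`, `w ↦ (w, σ (v (w)))` for `σ ∈ Gal(K/k)`, are jointly epimorphic for separated
targets. -/
lemma hom_ext_of_gal [IsGalois k K] {W Y : Over (Spec (.of k))} [IsSeparated Y.hom]
    (v : W ⟶ Over.mk (specMap k K)) (g h : W ⊗ Over.mk (specMap k K) ⟶ Y)
    (hgh : ∀ σ : K ≃ₐ[k] K, lift (𝟙 _) (v ≫ specGalOver σ) ≫ g =
      lift (𝟙 _) (v ≫ specGalOver σ) ≫ h) :
    g = h := by
  refine Over.OverMorphism.ext (Scheme.Cover.hom_ext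
    (Scheme.Pullback.openCoverOfLeft W.left.affineCover W.hom (specMap k K)) _ _ fun i => ?_)
  exact congrArg CommaMorphism.left (whiskerRight_comp_eq_of_gal v g h hgh
    (Over.homMk (U := Over.mk (W.left.affineCover.f i ≫ W.hom)) (W.left.affineCover.f i)))

/-- Galois descent of morphisms: for `Y` separated over `k`, the `k`-morphisms `Z ⟶ Y` are the
`Gal(K/k)`-invariant `k`-morphisms `Z × Spec K ⟶ Y`. -/
lemma existsUnique_fst_comp_eq [IsGalois k K] {Z Y : Over (Spec (.of k))} [IsSeparated Y.hom]
    (g : Z ⊗ Over.mk (specMap k K) ⟶ Y)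
    (hg : ∀ σ : K ≃ₐ[k] K, Z ◁ specGalOver σ ≫ g = g) :
    ∃! h : Z ⟶ Y, fst _ _ ≫ h = g := by
  let U := Over.mk (specMap k K)
  let π : (Z ⊗ U).left ⟶ Z.left := (fst Z U).left
  have : Flat (specMap k K) :=
    Flat.SpecMap_iff.mpr (RingHom.flat_algebraMap_iff.mpr inferInstance)
  have : Surjective (specMap k K) :=
    ⟨Function.surjective_to_subsingleton (α := PrimeSpectrum K) (β := PrimeSpectrum k) _⟩
  have : Flat π := inferInstanceAs (Flat (pullback.fst Z.hom (specMap k K)))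
  have : Surjective π := inferInstanceAs (Surjective (pullback.fst Z.hom (specMap k K)))
  have : QuasiCompact π := inferInstanceAs (QuasiCompact (pullback.fst Z.hom (specMap k K)))
  -- Descent condition: g(z, u) = g(z, u') on Z × U × U. By `hom_ext_of_gal` it suffices to take u'
  -- = σ(u), where it is the invariance of `g`.
  have key : fst (Z ⊗ U) U ≫ g = fst Z U ▷ U ≫ g := by
    refine hom_ext_of_gal (snd Z U) _ _ fun σ => ?_
    rw [lift_fst_assoc, Category.id_comp]
    refine (hg σ).symm.trans ?_
    rw [lift_whiskerRight_assoc, Category.id_comp]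
    congr 1
  have hdesc {V : Scheme.{u}} (g₁ g₂ : V ⟶ (Z ⊗ U).left) (h : g₁ ≫ π = g₂ ≫ π) :
      g₁ ≫ g.left = g₂ ≫ g.left := by
    let V' : Over (Spec (.of k)) := Over.mk (g₁ ≫ (Z ⊗ U).hom)
    have hw : g₂ ≫ (Z ⊗ U).hom = g₁ ≫ (Z ⊗ U).hom := by
      rw [← Over.w (fst Z U), reassoc_of% h]
    let g₁' : V' ⟶ Z ⊗ U := Over.homMk g₁
    let g₂' : V' ⟶ Z ⊗ U := Over.homMk g₂ hw
    have h' : g₁' ≫ fst Z U = g₂' ≫ fst Z U := Over.OverMorphism.ext h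
    have h1 := lift g₁' (g₂' ≫ snd Z U) ≫= key
    have h2 : lift (g₁' ≫ fst Z U) (g₂' ≫ snd Z U) = g₂' := by
      rw [h']
      ext1 <;> simp
    rw [lift_fst_assoc, lift_whiskerRight_assoc, h2] at h1
    exact congrArg CommaMorphism.left h1
  -- The projection `π` is flat, surjective and quasi-compact, hence an effective epimorphism.
  let d := EffectiveEpi.desc π g.left hdesc
  have hd : π ≫ d = g.left := EffectiveEpi.fac _ _ _
  refine ⟨Over.homMk d ?_, Over.OverMorphism.ext hd, fun h hh => Over.OverMorphism.ext ?_⟩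
  · rw [← cancel_epi π, reassoc_of% hd, Over.w]
    exact (Over.w (fst Z U)).symm
  · rw [← cancel_epi π]
    exact (congrArg CommaMorphism.left hh).trans hd.symm

/-- Two points x, y agree exactly when x / y is the unit. -/
lemma isPullback_diag_div {C : Type*} [Category C] [CartesianMonoidalCategory C] (G : C)
    [GrpObj G] :
    IsPullback (lift (𝟙 G) (𝟙 G)) (toUnit G) (fst G G / snd G G) η[G] := by
  have hw : lift (𝟙 G) (𝟙 G) ≫ (fst G G / snd G G) = toUnit G ≫ η[G] := by
    rw [GrpObj.comp_div, lift_fst, lift_snd, div_self', Hom.one_def]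
  refine ⟨⟨hw⟩, ⟨PullbackCone.IsLimit.mk _ (fun c => c.fst ≫ fst _ _) (fun c => ?_)
    (fun c => toUnit_unique _ _) (fun c m h1 _ => ?_)⟩⟩
  · have h := c.condition
    rw [GrpObj.comp_div, toUnit_unique c.snd (toUnit _), ← Hom.one_def, div_eq_one] at h
    rw [comp_lift, Category.comp_id]
    ext1
    · simp
    · simpa using h
  · rw [← h1, Category.assoc, lift_fst, Category.comp_id]

/-- The diagonal is a base change of the unit section, and a rational point over a field is a closed
immersion. -/
instance isSeparated_of_grpObj {k : Type u} [Field k] (G : Over (Spec (.of k))) [GrpObj G] :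
    IsSeparated G.hom where
  isClosedImmersion_diagonal := by
    have h : IsPullback (lift (𝟙 G) (𝟙 G)).left _ _ η[G].left :=
      (isPullback_diag_div G).map (Over.forget _)
    have : IsClosedImmersion (lift (𝟙 G) (𝟙 G)).left :=
      MorphismProperty.of_isPullback (P := @IsClosedImmersion) h.flip inferInstance
    exact this

/-! ### Endomorphisms of G_K as k-morphisms G × Spec K ⟶ G -/

lemma left_proj_hom {G : GroupScheme (Spec (.of k))} {W : Over (Spec (.of K))}
    (x : W ⟶ (baseChange K G).X) : (x.left ≫ proj K G) ≫ G.X.hom = W.hom ≫ specMap k K := by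
  rw [Category.assoc, (isPullback_proj K G).w, reassoc_of% (Over.w x)]

/-- A `K`-morphism `φ : G_K ⟶ G_K` as a `k`-morphism `G × Spec K ⟶ G`. -/
def flat {G : GroupScheme (Spec (.of k))} (φ : (baseChange K G).X ⟶ (baseChange K G).X) :
    G.X ⊗ Over.mk (specMap k K) ⟶ G.X :=
  Over.homMk (φ.left ≫ proj K G) ((left_proj_hom φ).trans (isPullback_proj K G).w.symm)

section

variable {G : GroupScheme (Spec (.of k))}

lemma lift_flat_left (φ : (baseChange K G).X ⟶ (baseChange K G).X) :
    (lift (flat φ) (snd _ _)).left = φ.left := by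
  refine (isPullback_proj K G).hom_ext ?_ ?_
  · exact congrArg CommaMorphism.left (lift_fst (flat φ) (snd _ _))
  · exact (congrArg CommaMorphism.left (lift_snd (flat φ) (snd _ _))).trans (Over.w φ).symm

lemma flat_injective :
    Function.Injective (flat : ((baseChange K G).X ⟶ (baseChange K G).X) → _) := fun φ ψ h =>
  Over.OverMorphism.ext (by rw [← lift_flat_left φ, h, lift_flat_left])

lemma flat_id : flat (𝟙 (baseChange K G).X) = fst _ _ :=
  Over.OverMorphism.ext (Category.id_comp _)

lemma flat_comp (φ ψ : (baseChange K G).X ⟶ (baseChange K G).X) :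
    flat (φ ≫ ψ) = lift (flat φ) (snd _ _) ≫ flat ψ := by
  refine Over.OverMorphism.ext ?_
  rw [Over.comp_left, lift_flat_left]
  exact Category.assoc _ _ _

lemma flat_actAt {F : GroupScheme (Spec (.of k))} (a : F.X ⊗ G.X ⟶ G.X) (f : Points K F) :
    flat (actAt a f) = lift (snd _ _ ≫ f) (fst _ _) ≫ a :=
  Over.OverMorphism.ext ((isPullback_proj K G).lift_fst _ _ _)

/-- The `K`-morphism `V ⟶ G_K` attached to a `k`-morphism `g : V ⟶ G` from a `K`-scheme `V`. -/
def sharp {V : Over (Spec (.of k))} (u : V ⟶ Over.mk (specMap k K)) (g : V ⟶ G.X) :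
    Over.mk u.left ⟶ (baseChange K G).X :=
  Over.homMk ((isPullback_proj K G).lift g.left u.left ((Over.w g).trans (Over.w u).symm))
    ((isPullback_proj K G).lift_snd _ _ _)

lemma sharp_left_proj {V : Over (Spec (.of k))} (u : V ⟶ Over.mk (specMap k K)) (g : V ⟶ G.X) :
    (sharp u g).left ≫ proj K G = g.left :=
  (isPullback_proj K G).lift_fst _ _ _

lemma sharp_surjective {V : Over (Spec (.of k))} (u : V ⟶ Over.mk (specMap k K)) :
    Function.Surjective (sharp u : (V ⟶ G.X) → _) := fun x => by
  refine ⟨Over.homMk (x.left ≫ proj K G) ((left_proj_hom x).trans (Over.w u)), ?_⟩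
  exact Over.OverMorphism.ext ((isPullback_proj K G).hom_ext (sharp_left_proj _ _)
      ((Over.w _).trans (Over.w _).symm))

lemma sharp_comp {V : Over (Spec (.of k))} (u : V ⟶ Over.mk (specMap k K)) (g : V ⟶ G.X)
    (φ : (baseChange K G).X ⟶ (baseChange K G).X) :
    sharp u g ≫ φ = sharp u (lift g u ≫ flat φ) := by
  refine Over.OverMorphism.ext ((isPullback_proj K G).hom_ext ?_ ?_)
  · rw [sharp_left_proj]
    have : (sharp u g).left = (lift g u).left := by
      refine (isPullback_proj K G).hom_ext ?_ ?_
      · exact (sharp_left_proj u g).trans (congrArg CommaMorphism.left (lift_fst g u)).symm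
      · exact (Over.w (sharp u g)).trans (congrArg CommaMorphism.left (lift_snd g u)).symm
    rw [Over.comp_left, Over.comp_left, this]
    exact Category.assoc _ _ _
  · exact (Over.w _).trans (Over.w _).symm

lemma sharp_mul {V : Over (Spec (.of k))} (u : V ⟶ Over.mk (specMap k K)) (g h : V ⟶ G.X) :
    sharp u (g * h) = sharp u g * sharp u h := by
  refine Over.OverMorphism.ext ((isPullback_proj K G).hom_ext ?_ ?_)
  · rw [sharp_left_proj, Hom.mul_def, Hom.mul_def, Over.comp_left, Over.comp_left, Category.assoc,
      baseChange_mul_proj, ← Category.assoc]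
    congr 1
    refine pullback.hom_ext ?_ ?_
    · rw [Category.assoc, map_fst, ← Category.assoc]
      refine (congrArg CommaMorphism.left (lift_fst g h)).trans ((sharp_left_proj u g).symm.trans ?_)
      exact congrArg (· ≫ proj K G)
        (congrArg CommaMorphism.left (lift_fst (sharp u g) (sharp u h))).symm
    · rw [Category.assoc, map_snd, ← Category.assoc]
      refine (congrArg CommaMorphism.left (lift_snd g h)).trans ((sharp_left_proj u h).symm.trans ?_)
      exact congrArg (· ≫ proj K G)
        (congrArg CommaMorphism.left (lift_snd (sharp u g) (sharp u h))).symm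
  · exact (Over.w _).trans (Over.w _).symm

/-- A `K`-scheme is a `k`-scheme `V` with a morphism to Spec K, and its `G_K`-points are the
`G`-points of `V`. Preservation of the unit comes for free, because the image of the unit is
idempotent. -/
lemma isMonHom_iff_flat (φ : (baseChange K G).X ⟶ (baseChange K G).X) :
    IsMonHom φ ↔ ∀ (V : Over (Spec (.of k))) (u : V ⟶ Over.mk (specMap k K)) (g h : V ⟶ G.X),
      lift (g * h) u ≫ flat φ = (lift g u ≫ flat φ) * (lift h u ≫ flat φ) := by
  constructor
  · intro _ V u g h
    have := MonObj.mul_comp (sharp u g) (sharp u h) φ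
    rw [← sharp_mul, sharp_comp, sharp_comp, sharp_comp, ← sharp_mul] at this
    refine Over.OverMorphism.ext ?_
    rw [← sharp_left_proj u, this, sharp_left_proj]
  · intro H
    have hmul {W : Over (Spec (.of K))} (x y : W ⟶ (baseChange K G).X) :
        (x * y) ≫ φ = (x ≫ φ) * (y ≫ φ) := by
      obtain ⟨V, u, rfl⟩ : ∃ (V : Over (Spec (.of k))) (u : V ⟶ Over.mk (specMap k K)),
          Over.mk u.left = W :=
        ⟨Over.mk (W.hom ≫ specMap k K), Over.homMk W.hom, rfl⟩
      obtain ⟨g, rfl⟩ := sharp_surjective u x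
      obtain ⟨h, rfl⟩ := sharp_surjective u y
      rw [← sharp_mul, sharp_comp, sharp_comp, sharp_comp, ← sharp_mul, H]
    refine ⟨?_, ?_⟩
    · have := hmul (1 : 𝟙_ (Over (Spec (.of K))) ⟶ (baseChange K G).X) 1
      rw [mul_one] at this
      rw [MonObj.one_eq_one]
      exact mul_eq_left.mp this.symm
    · rw [MonObj.mul_eq_mul, hmul, Hom.mul_def, ← MonObj.mul_eq_mul]
      congr 1

/-- Semilinearity fixes the component on Spec K, so only the projection to `G` remains to be
compared. -/
lemma sAut_ext {p q : SAut k (baseChange K G)} (h₁ : p.1.1 = q.1.1)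
    (h₂ : p.1.2.hom ≫ proj K G = q.1.2.hom ≫ proj K G) : p = q := by
  refine Subtype.ext (Prod.ext h₁ (Iso.ext ((isPullback_proj K G).hom_ext h₂ ?_)))
  rw [← p.2.comm, ← q.2.comm, h₁]

/-- After projection to `G`, the outer factor of the conjugation disappears, as `galMor` does not
move the `G`-coordinate. The inner factor remains, as precomposition. -/
lemma isGalEquivariant_iff_flat {F : GroupScheme (Spec (.of k))}
    (ρ : Points K F →* Aut (baseChange K G)) :
    IsGalEquivariant ρ ↔ ∀ (σ : K ≃ₐ[k] K) (f : Points K F),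
      flat (ρ (galPoints K F σ f)).hom.hom.hom = G.X ◁ specGalOver σ ≫ flat (ρ f).hom.hom.hom := by
  refine forall₂_congr fun σ f => ?_
  -- The inverse appears because `galMor` at σ acts on the second factor by Spec σ⁻¹.
  have hw : (G.X ◁ specGalOver σ).left = galMor K G σ⁻¹ := by
    refine (isPullback_proj K G).hom_ext ?_ ?_
    · exact (congrArg CommaMorphism.left (whiskerLeft_fst G.X (specGalOver σ))).trans
        (galMor_proj G σ⁻¹).symm
    · have hg : galMor K G σ⁻¹ ≫ (baseChange K G).X.hom =
          (baseChange K G).X.hom ≫ specGal σ := by rw [galMor_hom, inv_inv]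
      exact (congrArg CommaMorphism.left (whiskerLeft_snd G.X (specGalOver σ))).trans hg.symm
  have key : (galMor K G σ⁻¹ ≫ (ρ f).hom.hom.hom.left ≫ galMor K G σ) ≫ proj K G =
      (G.X ◁ specGalOver σ ≫ flat (ρ f).hom.hom.hom).left := by
    rw [Over.comp_left, hw, Category.assoc, Category.assoc, galMor_proj]
    rfl
  constructor
  · intro h
    refine Over.OverMorphism.ext (Eq.trans ?_ key)
    exact congrArg (fun p => p.1.2.hom ≫ proj K G) h
  · intro h
    refine sAut_ext ?_ ((congrArg CommaMorphism.left h).trans key.symm)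
    change (1 : K ≃ₐ[k] K) = σ * 1 * σ⁻¹
    rw [mul_one, mul_inv_cancel]

end

/-! ### Action axioms on points -/

namespace IsGroupAction

variable {S : Scheme.{u}} {F G : GroupScheme S} {a : F.X ⊗ G.X ⟶ G.X}

lemma lift_mul_comp (ha : IsGroupAction a) {V : Over S} (f g : V ⟶ F.X) (x : V ⟶ G.X) :
    lift (f * g) x ≫ a = lift f (lift g x ≫ a) ≫ a := by
  have := lift (lift f g) x ≫= ha.mul_act
  rwa [lift_whiskerRight_assoc, lift_lift_associator_hom_assoc, lift_whiskerLeft_assoc] at this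

lemma lift_one_comp (ha : IsGroupAction a) {V : Over S} (x : V ⟶ G.X) :
    lift 1 x ≫ a = x := by
  have := lift (toUnit V) x ≫= ha.one_act
  rwa [lift_whiskerRight_assoc, lift_leftUnitor_hom] at this

lemma lift_comp_mul (ha : IsGroupAction a) {V : Over S} (f : V ⟶ F.X) (x y : V ⟶ G.X) :
    lift f (x * y) ≫ a = (lift f x ≫ a) * (lift f y ≫ a) := by
  have := lift f (lift x y) ≫= ha.act_mul
  rw [lift_whiskerLeft_assoc, diagAction, comp_lift_assoc] at this
  simpa [Hom.mul_def] using this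

end IsGroupAction

/-- Associativity is stated on F × (F × G), so that `hom_ext_of_points` can split off the outer
factor `F`. -/
lemma isGroupAction_of_points {S : Scheme.{u}} {F G : GroupScheme S} {a : F.X ⊗ G.X ⟶ G.X}
    (h₁ : lift (fst F.X (F.X ⊗ G.X) * snd F.X (F.X ⊗ G.X) ≫ fst F.X G.X)
      (snd F.X (F.X ⊗ G.X) ≫ snd F.X G.X) ≫ a = F.X ◁ a ≫ a)
    (h₂ : lift 1 (𝟙 G.X) ≫ a = 𝟙 G.X)
    (h₃ : F.X ◁ μ[G.X] ≫ a = (F.X ◁ fst G.X G.X ≫ a) * (F.X ◁ snd G.X G.X ≫ a)) :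
    IsGroupAction a where
  mul_act := by
    rw [← h₁, ← Category.assoc]
    congr 1
    ext1
    · simp [MonObj.comp_mul, MonObj.mul_eq_mul]
    · simp
  one_act := by
    rw [← Category.comp_id (λ_ G.X).hom, ← h₂, ← Category.assoc]
    congr 1
    ext1
    · simp [MonObj.comp_one, MonObj.one_eq_one]
    · simp [leftUnitor_hom]
  act_mul := h₃

/-! ### From actions to equivariant homomorphisms -/

section

variable {F G : GroupScheme (Spec (.of k))} {a : F.X ⊗ G.X ⟶ G.X}

lemma actAt_mul (ha : IsGroupAction a) (f g : Points K F) :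
    actAt a (f * g) = actAt a g ≫ actAt a f := by
  refine flat_injective ?_
  rw [flat_comp, flat_actAt, flat_actAt, flat_actAt, comp_lift_assoc, lift_fst, lift_snd_assoc,
    ← ha.lift_mul_comp, MonObj.comp_mul]

lemma actAt_one (ha : IsGroupAction a) : actAt a (1 : Points K F) = 𝟙 _ := by
  refine flat_injective ?_
  rw [flat_id, flat_actAt, MonObj.comp_one, ha.lift_one_comp]

lemma isMonHom_actAt (ha : IsGroupAction a) (f : Points K F) : IsMonHom (actAt a f) := by
  refine (isMonHom_iff_flat _).mpr fun V u g h => ?_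
  simp only [flat_actAt, comp_lift_assoc, lift_fst, lift_snd_assoc]
  exact ha.lift_comp_mul _ _ _

/-- The homomorphism `F(K) → Aut(G_K)`, `f ↦ a_f`, attached to an action `a`. -/
def homOfAction (ha : IsGroupAction a) : Points K F →* Aut (baseChange K G) where
  toFun f :=
    haveI := isMonHom_actAt ha f
    haveI := isMonHom_actAt ha f⁻¹
    { hom := Grp.homMk (actAt a f)
      inv := Grp.homMk (actAt a f⁻¹)
      hom_inv_id := Grp.hom_ext _ _ (by
        change actAt a f ≫ actAt a f⁻¹ = 𝟙 _
        rw [← actAt_mul ha, inv_mul_cancel, actAt_one ha])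
      inv_hom_id := Grp.hom_ext _ _ (by
        change actAt a f⁻¹ ≫ actAt a f = 𝟙 _
        rw [← actAt_mul ha, mul_inv_cancel, actAt_one ha]) }
  map_one' := Iso.ext (Grp.hom_ext _ _ (actAt_one ha))
  map_mul' f g := Iso.ext (Grp.hom_ext _ _ (actAt_mul ha f g))

/-- Only the definition of `a` over `k` matters: moving `u` by σ in a(f(u), x) replaces f by f ∘
Spec σ and nothing else. -/
lemma Induces.isGalEquivariant {ρ : Points K F →* Aut (baseChange K G)} (h : Induces a ρ) :
    IsGalEquivariant ρ := by
  refine (isGalEquivariant_iff_flat ρ).mpr fun σ f => ?_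
  rw [h, h, flat_actAt, flat_actAt, comp_lift_assoc, whiskerLeft_fst, whiskerLeft_snd_assoc]
  rfl

lemma existsUnique_hom_of_action (ha : IsGroupAction a) :
    ∃! ρ : Points K F →* Aut (baseChange K G), IsGalEquivariant ρ ∧ Induces a ρ :=
  have h : Induces a (homOfAction (K := K) ha) := fun _ => rfl
  ⟨_, ⟨h.isGalEquivariant, h⟩, fun _ h' => MonoidHom.ext fun f => Iso.ext (Grp.hom_ext _ _
    ((h'.2 f).trans (h f).symm))⟩

end

/-! ### From equivariant homomorphisms to actions -/

lemma graphAt_fst {F : Over (Spec (.of k))} (f : Over.mk (specMap k K) ⟶ F)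
    (X : Over (Spec (.of k))) : graphAt f X ≫ fst _ _ = lift (snd _ _ ≫ f) (fst _ _) :=
  lift_fst _ _

lemma graphAt_snd {F : Over (Spec (.of k))} (f : Over.mk (specMap k K) ⟶ F)
    (X : Over (Spec (.of k))) : graphAt f X ≫ snd _ _ = snd _ _ :=
  lift_snd _ _

lemma hom_ext_of_graphAt [IsSepClosed K] {F X Y : Over (Spec (.of k))} [Smooth F.hom] [IsFinite F.hom]
    {g h : (F ⊗ X) ⊗ Over.mk (specMap k K) ⟶ Y}
    (H : ∀ f : Over.mk (specMap k K) ⟶ F, graphAt f X ≫ g = graphAt f X ≫ h) : g = h :=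
  (existsUnique_graphAt_comp F X Y fun f => graphAt f X ≫ h).unique H fun _ => rfl

section

variable [IsGalois k K]

lemma cancel_fst_specMap {X Y : Over (Spec (.of k))} [IsSeparated Y.hom] {g h : X ⟶ Y}
    (H : fst X (Over.mk (specMap k K)) ≫ g = fst X (Over.mk (specMap k K)) ≫ h) : g = h :=
  (existsUnique_fst_comp_eq (fst X (Over.mk (specMap k K)) ≫ h) fun σ => by
    rw [whiskerLeft_fst_assoc]).unique H rfl

variable [IsSepClosed K]

/-- Descent allows a test after base change to `K`, where F × X × Spec K is covered by its pieces.
-/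
lemma hom_ext_of_points {F X Y : Over (Spec (.of k))} [Smooth F.hom] [IsFinite F.hom]
    [IsSeparated Y.hom] {g h : F ⊗ X ⟶ Y}
    (H : ∀ f : Over.mk (specMap k K) ⟶ F,
      lift (snd X (Over.mk (specMap k K)) ≫ f) (fst _ _) ≫ g = lift (snd _ _ ≫ f) (fst _ _) ≫ h) :
    g = h := by
  refine cancel_fst_specMap (K := K) (hom_ext_of_graphAt fun f => ?_)
  rw [reassoc_of% graphAt_fst, reassoc_of% graphAt_fst, H]

variable {F G : GroupScheme (Spec (.of k))} [Smooth F.X.hom] [IsFinite F.X.hom]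

/-- The automorphisms ρ(f) glue to a morphism `b` on F × G × Spec K. Galois permutes the pieces,
equivariance makes `b` invariant, and `a` is its descent. -/
lemma existsUnique_mor_of_hom {ρ : Points K F →* Aut (baseChange K G)} (hρ : IsGalEquivariant ρ) :
    ∃! a : F.X ⊗ G.X ⟶ G.X, Induces a ρ := by
  rw [isGalEquivariant_iff_flat] at hρ
  obtain ⟨b, hb, -⟩ := existsUnique_graphAt_comp (K := K) F.X G.X G.X
    fun f => flat (ρ f).hom.hom.hom
  obtain ⟨a, ha, -⟩ := existsUnique_fst_comp_eq b fun σ => by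
    refine hom_ext_of_graphAt fun f => ?_
    -- The automorphism id × Spec σ carries the piece of f to the piece of σ⁻¹ f.
    have h : graphAt f G.X ≫ (F.X ⊗ G.X) ◁ specGalOver σ =
        G.X ◁ specGalOver σ ≫ graphAt (galPoints K F σ⁻¹ f) G.X := by
      have hf : specGalOver σ ≫ galPoints K F σ⁻¹ f = f := by
        change galPoints K F σ (galPoints K F σ⁻¹ f) = f
        rw [← MulAut.mul_apply, ← map_mul, mul_inv_cancel, map_one, MulAut.one_apply]
      rw [graphAt, graphAt, lift_whiskerLeft, comp_lift, comp_lift, whiskerLeft_fst,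
        whiskerLeft_snd, whiskerLeft_snd_assoc, hf]
    rw [reassoc_of% h, hb, hb, ← hρ, ← MulAut.mul_apply, ← map_mul, mul_inv_cancel, map_one,
      MulAut.one_apply]
  refine ⟨a, fun f => flat_injective ?_, fun a' ha' => hom_ext_of_points (K := K) fun f => ?_⟩
  · rw [flat_actAt, ← hb, ← ha, reassoc_of% graphAt_fst]
  · rw [← flat_actAt, ← ha' f, ← hb, ← ha, reassoc_of% graphAt_fst]

/-- On `K`-points the three axioms become the multiplicativity of `ρ`, ρ(1) = 1, and the fact that
each ρ(f) is a group homomorphism. -/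
lemma Induces.isGroupAction {ρ : Points K F →* Aut (baseChange K G)} {a : F.X ⊗ G.X ⟶ G.X}
    (h : Induces a ρ) : IsGroupAction a := by
  have hflat (f : Points K F) : lift (snd _ _ ≫ f) (fst _ _) ≫ a = flat (ρ f).hom.hom.hom := by
    rw [h, flat_actAt]
  have hV {V : Over (Spec (.of k))} (u : V ⟶ Over.mk (specMap k K)) (x : V ⟶ G.X)
      (f : Points K F) : lift (u ≫ f) x ≫ a = lift x u ≫ flat (ρ f).hom.hom.hom := by
    rw [← hflat, comp_lift_assoc, lift_fst, lift_snd_assoc]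
  refine isGroupAction_of_points ?_ ?_ ?_
  -- Associativity involves two points: the first reduction already leaves morphisms on (F × G) ×
  -- Spec K, so the inner factor needs only the splitting and no second descent.
  · refine hom_ext_of_points (K := K) fun f => hom_ext_of_graphAt fun g => ?_
    have he : graphAt g G.X ≫ lift (snd _ _ ≫ f) (fst _ _) =
        lift (snd _ _ ≫ f) (lift (snd _ _ ≫ g) (fst _ _)) := by
      rw [comp_lift, graphAt_fst, reassoc_of% graphAt_snd]
    rw [reassoc_of% he, reassoc_of% he, lift_whiskerLeft_assoc, comp_lift_assoc, MonObj.comp_mul,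
      lift_fst, lift_snd_assoc, lift_snd_assoc, lift_fst, lift_snd, ← MonObj.comp_mul, hflat,
      hflat, hV, map_mul]
    exact flat_comp _ _
  · refine cancel_fst_specMap (K := K) ?_
    rw [comp_lift_assoc, MonObj.comp_one, Category.comp_id]
    have := hV (snd _ _) (fst G.X _) 1
    rw [MonObj.comp_one] at this
    rw [this, map_one]
    exact (congrArg _ flat_id).trans (lift_fst _ _)
  · refine hom_ext_of_points (K := K) fun f => ?_
    rw [MonObj.comp_mul, lift_whiskerLeft_assoc, lift_whiskerLeft_assoc, lift_whiskerLeft_assoc,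
      hV, hV, hV, MonObj.mul_eq_mul, MonObj.comp_mul]
    exact (isMonHom_iff_flat _).mp inferInstance _ _ _ _

end

/-! ### Aut as the kernel of SAut ⟶ Γ, and homomorphisms on the semidirect product -/

lemma isMonHom_of_mul {C : Type*} [Category C] [CartesianMonoidalCategory C] {G H : C} [GrpObj G]
    [GrpObj H] (φ : G ⟶ H) (h : μ[G] ≫ φ = (φ ⊗ₘ φ) ≫ μ[H]) : IsMonHom φ := by
  refine ⟨?_, h⟩
  have := lift η[G] η[G] ≫= h
  rw [lift_map_assoc, ← Hom.mul_def, ← Category.assoc, ← Hom.mul_def, MonObj.one_eq_one,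
    mul_one] at this
  rw [MonObj.one_eq_one, MonObj.one_eq_one]
  exact mul_eq_left.mp this.symm

lemma IsSemialgebraic.exists_isMonHom {H : GroupScheme (Spec (.of K))} {s : H.X.left ⟶ H.X.left}
    (hs : IsSemialgebraic H (1 : K ≃ₐ[k] K) s) :
    ∃ φ : H.X ⟶ H.X, IsMonHom φ ∧ φ.left = s := by
  have hw : s ≫ H.X.hom = H.X.hom := by
    rw [← hs.comm, inv_one, specGal_one, Category.comp_id]
  refine ⟨Over.homMk s hw, isMonHom_of_mul _ (Over.OverMorphism.ext ?_), rfl⟩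
  rw [Over.comp_left, Over.comp_left, Over.tensorHom_left]
  refine hs.mul.symm.trans ?_
  congr 1

lemma ofAut_injective (H : GroupScheme (Spec (.of K))) : Function.Injective (SAut.ofAut k H) :=
  fun _ _ h => Iso.ext (Grp.hom_ext _ _ (Over.OverMorphism.ext
    (congrArg (fun p : SAut k H => p.1.2.hom) h)))

/-- Over σ = 1, semilinear means `K`-linear; this applies to `p` and to its inverse. -/
lemma exists_ofAut_eq {H : GroupScheme (Spec (.of K))} (p : SAut k H)
    (hp : SAut.toGal k H p = 1) : ∃ α : Aut H, SAut.ofAut k H α = p := by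
  obtain ⟨⟨σ, s⟩, hs⟩ := p
  obtain rfl : σ = 1 := hp
  obtain ⟨φ, _, hφ⟩ := IsSemialgebraic.exists_isMonHom hs
  have hs' := IsSemialgebraic.inv (s := s) hs
  rw [inv_one] at hs'
  obtain ⟨ψ, _, hψ⟩ := IsSemialgebraic.exists_isMonHom hs'
  refine ⟨{ hom := Grp.homMk φ
            inv := Grp.homMk ψ
            hom_inv_id := Grp.hom_ext _ _ (Over.OverMorphism.ext ?_)
            inv_hom_id := Grp.hom_ext _ _ (Over.OverMorphism.ext ?_) }, ?_⟩
  · change φ.left ≫ ψ.left = 𝟙 _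
    rw [hφ, hψ]
    exact Iso.hom_inv_id s
  · change ψ.left ≫ φ.left = 𝟙 _
    rw [hφ, hψ]
    exact Iso.inv_hom_id s
  · exact Subtype.ext (Prod.ext rfl (Iso.ext hφ))

variable {F G : GroupScheme (Spec (.of k))}

/-- Compatibility with the projections puts Φ(F(K)) into the kernel `Aut(G_K)`. Equivariance holds
because conjugation by γ_F(σ) is the Galois action on `F(K)`. -/
lemma existsUnique_hom_of_extension {Φ : PointsGal K F →* SAut k (baseChange K G)}
    (h₁ : ExtendsSplitting Φ) (h₂ : IsOverGal Φ) :
    ∃! ρ : Points K F →* Aut (baseChange K G), IsGalEquivariant ρ ∧ RestrictsTo Φ ρ := by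
  have hex (f : Points K F) :
      ∃ α : Aut (baseChange K G), SAut.ofAut k _ α = Φ (SemidirectProduct.inl f) :=
    exists_ofAut_eq _ (by rw [h₂, SemidirectProduct.rightHom_inl])
  choose r hr using hex
  refine ⟨MonoidHom.mk' r fun f g => ofAut_injective (k := k) _ ?_, ⟨fun σ f => ?_, fun f =>
    (hr f).symm⟩, fun ρ' h' => MonoidHom.ext fun f => ofAut_injective (k := k) _ ?_⟩
  · rw [map_mul, hr, hr, hr, map_mul, map_mul]
  · change SAut.ofAut k _ (r _) = _ * SAut.ofAut k _ (r f) * _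
    rw [hr, hr, SemidirectProduct.inl_aut, map_mul, map_mul, map_inv, map_inv, h₁]
  · exact (h'.2 f).symm.trans (hr f).symm

/-- This is the universal property of the semidirect product, whose compatibility condition is the
equivariance of `ρ`. -/
lemma existsUnique_extension_of_hom {ρ : Points K F →* Aut (baseChange K G)}
    (hρ : IsGalEquivariant ρ) :
    ∃! Φ : PointsGal K F →* SAut k (baseChange K G),
      ExtendsSplitting Φ ∧ IsOverGal Φ ∧ RestrictsTo Φ ρ := by
  let Φ : PointsGal K F →* SAut k (baseChange K G) :=
    SemidirectProduct.lift ((SAut.ofAut k _).comp ρ) (galSplitting K G) fun σ =>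
      MonoidHom.ext fun f => hρ σ f
  have hl (f : Points K F) : Φ (SemidirectProduct.inl f) = SAut.ofAut k _ (ρ f) :=
    SemidirectProduct.lift_inl ..
  have hr (σ : K ≃ₐ[k] K) : Φ (SemidirectProduct.inr σ) = galSplitting K G σ :=
    SemidirectProduct.lift_inr ..
  refine ⟨Φ, ⟨hr, fun x => ?_, hl⟩, fun Φ' h' => ?_⟩
  · refine DFunLike.congr_fun (f := (SAut.toGal k _).comp Φ) (g := SemidirectProduct.rightHom)
      (SemidirectProduct.hom_ext ?_ ?_) x
    · ext1 f
      change SAut.toGal k _ (Φ (SemidirectProduct.inl f)) = 1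
      rw [hl]
      rfl
    · ext1 σ
      change SAut.toGal k _ (Φ (SemidirectProduct.inr σ)) = σ
      rw [hr]
      rfl
  · refine SemidirectProduct.hom_ext (MonoidHom.ext fun f => ?_) (MonoidHom.ext fun σ => ?_)
    · exact (h'.2.2 f).trans (hl f).symm
    · exact (h'.1 σ).trans (hr σ).symm

end FiniteGroupAction

end

open FiniteGroupAction
theorem proposition2p1 {k K : Type u} [Field k] [Field K] [Algebra k K] [IsSepClosure k K]
    (F G : GroupScheme (Spec (.of k))) (hF : IsSmoothAlgebraic F) (hG : IsSmoothAlgebraic G)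
    (hfin : IsFinite F.X.hom) :
    -- the equivalence of the three existence statements
    List.TFAE [
      ∃ a : F.X ⊗ G.X ⟶ G.X, IsGroupAction a,
      ∃ ρ : Points K F →* Aut (baseChange K G), IsGalEquivariant ρ,
      ∃ Φ : PointsGal K F →* SAut k (baseChange K G), ExtendsSplitting Φ] ∧
    -- actions correspond to equivariant homomorphisms through `a ↦ (f ↦ a_f)`
    (∀ a : F.X ⊗ G.X ⟶ G.X, IsGroupAction a →
      ∃! ρ : Points K F →* Aut (baseChange K G), IsGalEquivariant ρ ∧ Induces a ρ) ∧
    (∀ ρ : Points K F →* Aut (baseChange K G), IsGalEquivariant ρ →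
      ∃! a : F.X ⊗ G.X ⟶ G.X, IsGroupAction a ∧ Induces a ρ) ∧
    -- equivariant homomorphisms correspond to homomorphisms on `F_Γ` through restriction to `F(K)`
    (∀ Φ : PointsGal K F →* SAut k (baseChange K G), ExtendsSplitting Φ → IsOverGal Φ →
      ∃! ρ : Points K F →* Aut (baseChange K G), IsGalEquivariant ρ ∧ RestrictsTo Φ ρ) ∧
    (∀ ρ : Points K F →* Aut (baseChange K G), IsGalEquivariant ρ →
      ∃! Φ : PointsGal K F →* SAut k (baseChange K G),
        ExtendsSplitting Φ ∧ IsOverGal Φ ∧ RestrictsTo Φ ρ) := by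
  have := hF.smooth
  have : IsSepClosed K := IsSepClosure.sep_closed k
  have : IsGalois k K := IsSepClosure.isGalois
  -- The morphism `a` is unique among all morphisms inducing `ρ`, and any such morphism is
  -- automatically an action.
  have h₂ (ρ : Points K F →* Aut (baseChange K G)) (hρ : IsGalEquivariant ρ) :
      ∃! a : F.X ⊗ G.X ⟶ G.X, IsGroupAction a ∧ Induces a ρ := by
    obtain ⟨a, ha, huniq⟩ := existsUnique_mor_of_hom hρ
    exact ⟨a, ⟨ha.isGroupAction, ha⟩, fun b hb => huniq b hb.2⟩
  refine ⟨?_, fun a ha => existsUnique_hom_of_action ha, h₂,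
    fun Φ => existsUnique_hom_of_extension, fun ρ => existsUnique_extension_of_hom⟩
  tfae_have 1 → 2 := fun ⟨a, ha⟩ => (existsUnique_hom_of_action ha).exists.imp fun _ h => h.1
  tfae_have 2 → 1 := fun ⟨ρ, hρ⟩ => (h₂ ρ hρ).exists.imp fun _ h => h.1
  tfae_have 2 → 3 := fun ⟨ρ, hρ⟩ => (existsUnique_extension_of_hom hρ).exists.imp fun _ h => h.1
  -- Without compatibility with the projections to `Γ`, `Φ` need not map `F(K)` into `Aut(G_K)`,
  -- but the trivial homomorphism is always equivariant.
  tfae_have 3 → 2 := fun _ => ⟨1, fun σ f => by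
    rw [MonoidHom.one_apply, MonoidHom.one_apply, map_one, mul_one, mul_inv_cancel]⟩
  tfae_finish
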